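/- Let $d\ge 1$, let $\tau$ be the uniform probability measure on the unit sphere $\mathbb S^{d-1}\subset\mathbb R^d$, and let $G$ be a subgroup of the group $\mathcal S_d$ of permutations of $\{1,\dots,d\}$, acting on $\mathbb S^{d-1}$ by $(\sigma\cdot x)_u=x_{\sigma^{-1}(u)}$. Let $\kappa:[-1,1]\to\mathbb R$ be a measurable (for instance, continuous) function such that the dot-product kernel $K(x,x')=\kappa(\langle x,x'\rangle)$ is positive semidefinite on $\mathbb S^{d-1}$, and define its invariant counterpart $$K_G(x,x')=\frac1{|G|}\sum_{\sigma\in G}\kappa(\langle\sigma\cdot x,x'\rangle).$$ Then $K_G$ is positive semidefinite as well, and the reproducing kernel Hilbert spaces $\mathcal H_K$ and $\mathcal H_{K_G}$ of $K$ and $K_G$ consist of square-integrable functions with respect to $\tau$. For $f^*\in L^2(d\tau)$, $\lambda\ge 0$ and $\mathcal H\in\{\mathcal H_K,\mathcal H_{K_G}\}$, define the approximation error $$A_{\mathcal H}(\lambda,f^*)=\inf_{f\in\mathcal H}\ \|f-f^*\|_{L^2(d\tau)}^2+\lambda\|f\|_{\mathcal H}^2 .$$ If $f^*$ is $G$-invariant,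 that is, for every $\sigma\in G$ one has $f^*(\sigma\cdot x)=f^*(x)$ for $\tau$-almost every $x$, then for every $\lambda\ge 0$ $$A_{\mathcal H_K}(\lambda,f^*)=A_{\mathcal H_{K_G}}(\lambda,f^*).$$ -/

import Mathlib

open MeasureTheory

namespace InvariantKernel

/-- The unit sphere of `ℝ^d` (with its Euclidean norm). -/
abbrev Sph (d : ℕ) : Type := Metric.sphere (0 : EuclideanSpace ℝ (Fin d)) 1

/-- The uniform probability measure on the sphere: normalized surface measure. -/
noncomputable def unif (d : ℕ) : Measure (Sph d) :=
  ((volume : Measure (EuclideanSpace ℝ (Fin d))).toSphere Set.univ)⁻¹ •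
    (volume : Measure (EuclideanSpace ℝ (Fin d))).toSphere

/-- The action of a permutation on the sphere, `(σ · x) u = x (σ⁻¹ u)`. -/
noncomputable def act {d : ℕ} (σ : Equiv.Perm (Fin d)) (x : Sph d) : Sph d :=
  ⟨LinearIsometryEquiv.piLpCongrLeft 2 ℝ ℝ σ x.1, by simp⟩

theorem act_apply {d : ℕ} (σ : Equiv.Perm (Fin d)) (x : Sph d) (u : Fin d) :
    (act σ x).1 u = x.1 (σ⁻¹ u) := rfl

/-- The dot-product kernel `K(x, x') = κ(⟨x, x'⟩)` on the sphere. -/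
noncomputable def dotKernel (d : ℕ) (κ : ℝ → ℝ) : Matrix (Sph d) (Sph d) ℝ :=
  fun x x' => κ (inner ℝ x.1 x'.1)

open Classical in
/-- The invariant kernel `K_G(x, x') = |G|⁻¹ ∑_{σ ∈ G} κ(⟨σ · x, x'⟩)`. -/
noncomputable def invKernel {d : ℕ} (G : Subgroup (Equiv.Perm (Fin d))) (κ : ℝ → ℝ) :
    Matrix (Sph d) (Sph d) ℝ :=
  fun x x' => (Fintype.card G : ℝ)⁻¹ * ∑ σ : G, κ (inner ℝ (act σ.1 x).1 x'.1)

/-- `K` is the (scalar) reproducing kernel of the Hilbert space `H` of real functions on `X`.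
The kernel of an `RKHS` takes values in the operators on `ℝ`, which are identified with the
scalars by evaluating at `1`. -/
def HasKernel {X : Type*} (H : Type*) [NormedAddCommGroup H] [InnerProductSpace ℝ H]
    [CompleteSpace H] [RKHS ℝ H X ℝ] (K : Matrix X X ℝ) : Prop :=
  ∀ x y : X, RKHS.kernel H x y 1 = K x y

/-- The approximation error `inf_{f ∈ H} ‖f - f⋆‖²_{L²} + lam ‖f‖²_H`. -/
noncomputable def approxError {d : ℕ} (H : Type*) [NormedAddCommGroup H]
    [InnerProductSpace ℝ H] [RKHS ℝ H (Sph d) ℝ] (lam : ℝ) (fstar : Sph d → ℝ) : ℝ :=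
  ⨅ f : H, ((∫ x, (f x - fstar x) ^ 2 ∂(unif d)) + lam * ‖f‖ ^ 2)

end InvariantKernel

/-!
The space of the averaged kernel `K_G` is the subspace of `G`-invariant functions of the space of
`K`, with the same norm, and averaging over orbits is the orthogonal projection onto it.

Since `K` is invariant under the simultaneous action on both arguments, averaging over one argument
is the same as averaging over both (`sum_sum_kernel`). So the quadratic form of `K_G` is that of `K`
evaluated at averaged coefficients (`quadForm_sumTranslates`). This shows that `K_G` is positive
semidefinite, and that sending the section of `K_G` at `x` to the mean of the sections of `K` over
the orbit of `x` extends to a contraction `T : H_{K_G} → H_K` (`exists_contraction`; it is in fact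
isometric). By the reproducing property the adjoint of `T` takes a function to its orbit mean
(`exists_orbitMean`), and `T F` is the same function as `F` (`exists_coe_eq`).

Hence a competitor `F ∈ H_{K_G}` is also a competitor in `H_K` of no larger norm, and the orbit mean
of a competitor `f ∈ H_K` is a competitor in `H_{K_G}` of no larger norm. By convexity of the square
and invariance of the measure, the orbit mean is at least as close in `L²` to the invariant target
(`integral_orbitMean_sub_sq_le`). The two infima therefore coincide. Square integrability holds
because functions in `H_K` are pointwise limits of measurable functions and are bounded by
`√(κ 1) * ‖f‖`.
-/

namespace InvariantKernel

open scoped Pointwise RealInnerProductSpace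

/-! ### Averaging a kernel over a finite group -/

section Averaging

variable {Γ X : Type*} [Group Γ] [Fintype Γ] [MulAction Γ X]

/-- The quadratic form `∑ x y, c x * K x y * c y` of a kernel, on finitely supported `c`. -/
noncomputable def quadForm (K : Matrix X X ℝ) (c : X →₀ ℝ) : ℝ :=
  c.sum fun x a ↦ c.sum fun y b ↦ a * K x y * b

variable (Γ) in
/-- The average of a kernel over a finite group acting on its first argument. -/
noncomputable def avgKernel (K : Matrix X X ℝ) : Matrix X X ℝ :=
  fun x y ↦ (Fintype.card Γ : ℝ)⁻¹ * ∑ g : Γ, K (g • x) y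

variable (Γ) in
/-- The sum of the translates of a finitely supported function. -/
noncomputable def sumTranslates : (X →₀ ℝ) →ₗ[ℝ] (X →₀ ℝ) :=
  ∑ g : Γ, Finsupp.lmapDomain ℝ ℝ (g • ·)

variable (Γ) in
lemma sum_sumTranslates (c : X →₀ ℝ) {h : X → ℝ → ℝ} (h0 : ∀ x, h x 0 = 0)
    (hadd : ∀ x a b, h x (a + b) = h x a + h x b) :
    (sumTranslates Γ c).sum h = ∑ g : Γ, c.sum fun x a ↦ h (g • x) a := by
  rw [sumTranslates, LinearMap.sum_apply, ← Finsupp.sum_finsetSum_index h0 hadd]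
  refine Finset.sum_congr rfl fun g _ ↦ ?_
  rw [Finsupp.lmapDomain_apply, Finsupp.sum_mapDomain_index h0 hadd]

/-- For an invariant kernel, averaging over one argument is the same as averaging over both. -/
lemma sum_sum_kernel {K : Matrix X X ℝ} (hinv : ∀ (g : Γ) x y, K (g • x) (g • y) = K x y)
    (x y : X) :
    ∑ g : Γ, ∑ h : Γ, K (g • x) (h • y) = (Fintype.card Γ : ℝ) ^ 2 * avgKernel Γ K x y := by
  have hne : (Fintype.card Γ : ℝ) ≠ 0 := by exact_mod_cast Fintype.card_ne_zero
  rw [Finset.sum_comm]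
  have key (h : Γ) : ∑ g : Γ, K (g • x) (h • y) = ∑ g : Γ, K (g • x) y := by
    rw [← Equiv.sum_comp (Equiv.mulLeft h)]
    simp [mul_smul, hinv]
  simp only [key, Finset.sum_const, Finset.card_univ, nsmul_eq_mul, avgKernel]
  field_simp

lemma quadForm_sumTranslates {K : Matrix X X ℝ}
    (hinv : ∀ (g : Γ) x y, K (g • x) (g • y) = K x y) (c : X →₀ ℝ) :
    quadForm K (sumTranslates Γ c) = (Fintype.card Γ : ℝ) ^ 2 * quadForm (avgKernel Γ K) c := by
  have inner_sum (x : X) (a : ℝ) : ((sumTranslates Γ c).sum fun y b ↦ a * K x y * b) =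
      ∑ h : Γ, c.sum fun y b ↦ a * K x (h • y) * b :=
    sum_sumTranslates Γ c (by simp) (by intros; ring)
  unfold quadForm
  simp only [inner_sum]
  rw [sum_sumTranslates Γ c (by simp)
    (by intros; simp [Finsupp.sum, add_mul, Finset.sum_add_distrib])]
  simp only [Finsupp.sum, Finset.mul_sum]
  rw [Finset.sum_comm]
  refine Finset.sum_congr rfl fun x _ ↦ ?_
  have swap (g : Γ) : ∑ h : Γ, ∑ y ∈ c.support, c x * K (g • x) (h • y) * c y =
      ∑ y ∈ c.support, ∑ h : Γ, c x * K (g • x) (h • y) * c y := Finset.sum_comm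
  simp only [swap]
  rw [Finset.sum_comm]
  refine Finset.sum_congr rfl fun y _ ↦ ?_
  simp only [← Finset.mul_sum, ← Finset.sum_mul, sum_sum_kernel hinv]
  ring

lemma posSemidef_avgKernel {K : Matrix X X ℝ}
    (hinv : ∀ (g : Γ) x y, K (g • x) (g • y) = K x y) (hK : K.PosSemidef) :
    (avgKernel Γ K).PosSemidef := by
  have hpos : 0 < (Fintype.card Γ : ℝ) ^ 2 := by
    have : 0 < Fintype.card Γ := Fintype.card_pos
    positivity
  refine ⟨?_, fun c ↦ ?_⟩
  · ext x y
    have hsymm (a b : X) : K a b = K b a := by simpa using hK.1.apply b a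
    refine mul_left_cancel₀ hpos.ne' ?_
    simp only [Matrix.conjTranspose_apply, star_trivial, ← sum_sum_kernel hinv]
    rw [Finset.sum_comm]
    exact Finset.sum_congr rfl fun g _ ↦ Finset.sum_congr rfl fun h _ ↦ hsymm _ _
  · have h := hK.2 (sumTranslates Γ c)
    simp only [star_trivial] at h ⊢
    exact nonneg_of_mul_nonneg_right ((quadForm_sumTranslates hinv c).symm ▸ h) hpos

end Averaging

/-! ### Scalar reproducing kernel Hilbert spaces -/

section ScalarRKHS

variable {X : Type*} {H : Type*} [NormedAddCommGroup H] [InnerProductSpace ℝ H]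
  [CompleteSpace H] [RKHS ℝ H X ℝ]

variable (H) in
/-- The kernel section `K(·, x)`, as an element of the reproducing kernel Hilbert space. -/
noncomputable def kerSec (x : X) : H := RKHS.kerFun H x 1

lemma inner_kerSec (x : X) (f : H) : ⟪kerSec H x, f⟫ = f x := by
  simp [kerSec]

lemma HasKernel.kerSec_apply {K : Matrix X X ℝ} (hH : HasKernel H K) (x y : X) :
    kerSec H y x = K x y := by
  rw [kerSec, RKHS.kerFun_apply, hH]

variable (H) in
lemma dense_span_kerSec : Dense (Submodule.span ℝ (Set.range (kerSec H : X → H)) : Set H) := by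
  rw [Submodule.dense_iff_topologicalClosure_eq_top, eq_top_iff, ← RKHS.kerFun_dense H]
  refine Submodule.topologicalClosure_mono (Submodule.span_le.2 ?_)
  rintro _ ⟨x, v, rfl⟩
  have : RKHS.kerFun H x v = v • kerSec H x := by
    rw [kerSec, ← map_smul, smul_eq_mul, mul_one]
  rw [this]
  exact Submodule.smul_mem _ _ (Submodule.subset_span ⟨x, rfl⟩)

variable (H) in
/-- The combination `∑ x, c x • K(·, x)` of kernel sections. -/
noncomputable def kerComb : (X →₀ ℝ) →ₗ[ℝ] H := Finsupp.linearCombination ℝ (kerSec H)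

variable (H) in
lemma denseRange_kerComb : DenseRange (kerComb H : (X →₀ ℝ) → H) := by
  have h := dense_span_kerSec (X := X) H
  rw [← Finsupp.range_linearCombination] at h
  exact h

lemma HasKernel.norm_kerComb_sq {K : Matrix X X ℝ} (hH : HasKernel H K) (c : X →₀ ℝ) :
    ‖kerComb H c‖ ^ 2 = quadForm K c := by
  rw [← real_inner_self_eq_norm_sq, kerComb, Finsupp.linearCombination_apply, Finsupp.sum_inner]
  refine Finsupp.sum_congr fun x _ ↦ ?_
  rw [Finsupp.inner_sum]
  refine Finsupp.sum_congr fun y _ ↦ ?_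
  rw [real_inner_smul_left, real_inner_smul_right, inner_kerSec, hH.kerSec_apply]
  ring

lemma HasKernel.abs_apply_le {K : Matrix X X ℝ} (hH : HasKernel H K) (f : H) (x : X) :
    |f x| ≤ √(K x x) * ‖f‖ := by
  have hnorm : ‖kerSec H x‖ = √(K x x) := by
    rw [← hH.kerSec_apply, ← inner_kerSec, real_inner_self_eq_norm_sq,
      Real.sqrt_sq (norm_nonneg _)]
  rw [← inner_kerSec, ← hnorm]
  exact abs_real_inner_le_norm _ _

/-- The functions of the space are pointwise limits of combinations of kernel sections, so they
are measurable as soon as the kernel sections are. -/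
lemma HasKernel.measurable [MeasurableSpace X] {K : Matrix X X ℝ} (hH : HasKernel H K)
    (hK : ∀ y, Measurable fun x ↦ K x y) (f : H) : Measurable f := by
  have hspan : ∀ g ∈ Submodule.span ℝ (Set.range (kerSec H : X → H)), Measurable g := by
    intro g hg
    induction hg using Submodule.span_induction with
    | mem g hg =>
      obtain ⟨y, rfl⟩ := hg
      simpa only [← hH.kerSec_apply] using hK y
    | zero => rw [RKHS.coe_zero]; exact measurable_zero
    | add g h _ _ hg hh => rw [RKHS.coe_add]; exact hg.add hh
    | smul a g _ hg => rw [RKHS.coe_smul]; exact hg.const_smul a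
  obtain ⟨u, hu, hlim⟩ := mem_closure_iff_seq_limit.1 (dense_span_kerSec (X := X) H f)
  refine measurable_of_tendsto_metrizable (fun n ↦ hspan _ (hu n)) (tendsto_pi_nhds.2 fun x ↦ ?_)
  exact ((RKHS.continuous_eval x).tendsto f).comp hlim

lemma HasKernel.memLp [MeasurableSpace X] {K : Matrix X X ℝ} (hH : HasKernel H K)
    (hK : ∀ y, Measurable fun x ↦ K x y) {C : ℝ} (hC : ∀ x, K x x ≤ C)
    (μ : Measure X) [IsFiniteMeasure μ] (f : H) : MemLp f 2 μ := by
  refine MemLp.of_bound (hH.measurable hK f).aestronglyMeasurable (√C * ‖f‖)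
    (Filter.Eventually.of_forall fun x ↦ (hH.abs_apply_le f x).trans ?_)
  gcongr
  exact hC x

end ScalarRKHS

/-! ### The space of the averaged kernel inside the space of the kernel -/

section Comparison

variable {Γ X : Type*} [Group Γ] [Fintype Γ] [MulAction Γ X]
  {H : Type*} [NormedAddCommGroup H] [InnerProductSpace ℝ H] [CompleteSpace H] [RKHS ℝ H X ℝ]
  {HG : Type*} [NormedAddCommGroup HG] [InnerProductSpace ℝ HG] [CompleteSpace HG]
  [RKHS ℝ HG X ℝ]

lemma kerComb_sumTranslates_single (x : X) :
    kerComb H (sumTranslates Γ (Finsupp.single x 1)) = ∑ g : Γ, kerSec H (g • x) := by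
  simp [sumTranslates, kerComb]

/-- The section of the averaged kernel at `x` is sent to the mean of the sections of `K` over the
orbit of `x`; by `quadForm_sumTranslates` this preserves norms of combinations of sections, hence
extends to the whole space. -/
lemma exists_contraction {K : Matrix X X ℝ} (hinv : ∀ (g : Γ) x y, K (g • x) (g • y) = K x y)
    (hH : HasKernel H K) (hHG : HasKernel HG (avgKernel Γ K)) :
    ∃ T : HG →L[ℝ] H, ‖T‖ ≤ 1 ∧
      ∀ x, T (kerSec HG x) = (Fintype.card Γ : ℝ)⁻¹ • ∑ g : Γ, kerSec H (g • x) := by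
  have hne : (Fintype.card Γ : ℝ) ≠ 0 := by exact_mod_cast Fintype.card_ne_zero
  let A : (X →₀ ℝ) →ₗ[ℝ] H := (Fintype.card Γ : ℝ)⁻¹ • kerComb H ∘ₗ sumTranslates Γ
  have hA (c : X →₀ ℝ) : ‖A c‖ ≤ 1 * ‖kerComb HG c‖ := by
    rw [one_mul]
    refine le_of_eq ((sq_eq_sq₀ (norm_nonneg _) (norm_nonneg _)).1 ?_)
    rw [hHG.norm_kerComb_sq, LinearMap.smul_apply, norm_smul, mul_pow, LinearMap.comp_apply,
      hH.norm_kerComb_sq, quadForm_sumTranslates hinv, Real.norm_eq_abs, sq_abs]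
    field_simp
  refine ⟨A.extendOfNorm (kerComb HG),
    LinearMap.opNorm_extendOfNorm_le (denseRange_kerComb HG) zero_le_one hA, fun x ↦ ?_⟩
  have hx : kerSec HG x = kerComb HG (Finsupp.single x 1) := by simp [kerComb]
  rw [hx, LinearMap.extendOfNorm_eq (denseRange_kerComb HG) ⟨1, hA⟩, ← kerComb_sumTranslates_single]
  rfl

/-- The orbit mean of a function of `H` belongs to `HG`, with no larger norm. -/
lemma exists_orbitMean {K : Matrix X X ℝ} (hinv : ∀ (g : Γ) x y, K (g • x) (g • y) = K x y)
    (hH : HasKernel H K) (hHG : HasKernel HG (avgKernel Γ K)) (f : H) :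
    ∃ F : HG, ‖F‖ ≤ ‖f‖ ∧ ∀ x, F x = (Fintype.card Γ : ℝ)⁻¹ * ∑ g : Γ, f (g • x) := by
  obtain ⟨T, hT, hTk⟩ := exists_contraction hinv hH hHG
  refine ⟨T.adjoint f, ?_, fun x ↦ ?_⟩
  · refine (T.adjoint.le_of_opNorm_le (c := 1) ?_ f).trans_eq (one_mul _)
    rwa [LinearIsometryEquiv.norm_map]
  · rw [← inner_kerSec, ContinuousLinearMap.adjoint_inner_right, hTk, real_inner_smul_left,
      sum_inner]
    simp only [inner_kerSec]

/-- Each function of `HG` belongs to `H`, with no larger norm. -/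
lemma exists_coe_eq {K : Matrix X X ℝ} (hinv : ∀ (g : Γ) x y, K (g • x) (g • y) = K x y)
    (hH : HasKernel H K) (hHG : HasKernel HG (avgKernel Γ K)) (F : HG) :
    ∃ f : H, ‖f‖ ≤ ‖F‖ ∧ ⇑f = ⇑F := by
  obtain ⟨T, hT, hTk⟩ := exists_contraction hinv hH hHG
  -- The adjoint of `T` sends the section of `K` at `x` to that of the averaged kernel.
  have hadj (x : X) : T.adjoint (kerSec H x) = kerSec HG x := by
    refine RKHS.ext fun y ↦ ?_
    rw [hHG.kerSec_apply, ← inner_kerSec, ContinuousLinearMap.adjoint_inner_right, hTk,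
      real_inner_smul_left, sum_inner]
    simp only [inner_kerSec, hH.kerSec_apply, avgKernel]
  refine ⟨T F, (T.le_of_opNorm_le hT F).trans_eq (one_mul _), funext fun x ↦ ?_⟩
  rw [← inner_kerSec, ← ContinuousLinearMap.adjoint_inner_left, hadj, inner_kerSec]

end Comparison

/-! ### Orbit means and the distance to an invariant function -/

/-- Taking orbit means does not increase the `L²` distance to an invariant function, by convexity
of the square. -/
lemma integral_orbitMean_sub_sq_le {Γ X : Type*} [Group Γ] [Fintype Γ] [MulAction Γ X]
    [MeasurableSpace X] {μ : Measure X} (hμ : ∀ g : Γ, MeasurePreserving (g • · : X → X) μ μ)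
    {f F fstar : X → ℝ} (hf : MemLp f 2 μ) (hfstar : MemLp fstar 2 μ)
    (hF : ∀ x, F x = (Fintype.card Γ : ℝ)⁻¹ * ∑ g : Γ, f (g • x))
    (hinv : ∀ g : Γ, ∀ᵐ x ∂μ, fstar (g • x) = fstar x) :
    ∫ x, (F x - fstar x) ^ 2 ∂μ ≤ ∫ x, (f x - fstar x) ^ 2 ∂μ := by
  have hpos : 0 < (Fintype.card Γ : ℝ) := by exact_mod_cast Fintype.card_pos
  have hint : Integrable (fun x ↦ (f x - fstar x) ^ 2) μ := (hf.sub hfstar).integrable_sq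
  have hintg (g : Γ) : Integrable (fun x ↦ (f (g • x) - fstar (g • x)) ^ 2) μ :=
    (hμ g).integrable_comp_of_integrable hint
  have hcomp (g : Γ) : ∫ x, (f (g • x) - fstar (g • x)) ^ 2 ∂μ = ∫ x, (f x - fstar x) ^ 2 ∂μ := by
    have h := integral_map (hμ g).measurable.aemeasurable
      (((hμ g).map_eq).symm ▸ hint.aestronglyMeasurable)
    rw [(hμ g).map_eq] at h
    exact h.symm
  calc ∫ x, (F x - fstar x) ^ 2 ∂μ
      ≤ ∫ x, (Fintype.card Γ : ℝ)⁻¹ * ∑ g : Γ, (f (g • x) - fstar (g • x)) ^ 2 ∂μ := by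
        refine integral_mono_of_nonneg (Filter.Eventually.of_forall fun x ↦ sq_nonneg _)
          ((integrable_finsetSum _ fun g _ ↦ hintg g).const_mul _) ?_
        filter_upwards [Filter.eventually_all.2 hinv] with x hx
        have h1 : F x - fstar x =
            (Fintype.card Γ : ℝ)⁻¹ * ∑ g : Γ, (f (g • x) - fstar (g • x)) := by
          simp only [hx, hF, Finset.sum_sub_distrib, Finset.sum_const, Finset.card_univ,
            nsmul_eq_mul]
          field_simp
        have h2 := sq_sum_le_card_mul_sum_sq (s := Finset.univ)
          (f := fun g : Γ ↦ f (g • x) - fstar (g • x))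
        rw [Finset.card_univ] at h2
        change (F x - fstar x) ^ 2 ≤ _
        rw [h1, mul_pow]
        calc _ ≤ ((Fintype.card Γ : ℝ)⁻¹) ^ 2 * ((Fintype.card Γ : ℝ) *
                ∑ g : Γ, (f (g • x) - fstar (g • x)) ^ 2) := by gcongr
          _ = _ := by field_simp
    _ = ∫ x, (f x - fstar x) ^ 2 ∂μ := by
        rw [integral_const_mul, integral_finsetSum _ fun g _ ↦ hintg g]
        simp only [hcomp, Finset.sum_const, Finset.card_univ, nsmul_eq_mul]
        field_simp

/-! ### The sphere, its uniform measure and the permutation action -/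

section Sphere

variable {d : ℕ}

/-- Permutations of the coordinates act on the sphere by `act`. -/
noncomputable instance permActionSphere : MulAction (Equiv.Perm (Fin d)) (Sph d) where
  smul := act
  one_smul x := Subtype.ext (PiLp.ext fun u ↦ act_apply 1 x u)
  mul_smul _ _ _ := Subtype.ext (PiLp.ext fun _ ↦ rfl)

lemma isFiniteMeasure_unif (hd : 1 ≤ d) : IsFiniteMeasure (unif d) := by
  have : Nonempty (Fin d) := ⟨⟨0, hd⟩⟩
  refine Measure.smul_finite _ (ENNReal.inv_ne_top.2 ?_)
  rw [Ne, Measure.measure_univ_eq_zero]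
  exact Measure.toSphere_ne_zero _

lemma measurePreserving_act (σ : Equiv.Perm (Fin d)) :
    MeasurePreserving (act σ) (unif d) (unif d) := by
  let L := LinearIsometryEquiv.piLpCongrLeft 2 ℝ ℝ σ
  have hmeas : Measurable (act σ) :=
    (L.continuous.measurable.comp measurable_subtype_coe).subtype_mk
  refine MeasurePreserving.smul_measure ⟨hmeas, ?_⟩ _
  ext s hs
  rw [Measure.map_apply hmeas hs, Measure.toSphere_apply' _ (hmeas hs),
    Measure.toSphere_apply' _ hs]
  -- The cone over the preimage of `s` is the preimage of the cone over `s`.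
  have hcone : Set.Ioo (0 : ℝ) 1 • ((↑) '' (act σ ⁻¹' s) : Set (EuclideanSpace ℝ (Fin d))) =
      L ⁻¹' (Set.Ioo (0 : ℝ) 1 • ((↑) '' s)) := by
    ext y
    simp only [Set.mem_smul, Set.mem_image, Set.mem_preimage]
    constructor
    · rintro ⟨r, hr, _, ⟨x, hx, rfl⟩, rfl⟩
      exact ⟨r, hr, _, ⟨act σ x, hx, rfl⟩, (L.map_smul r x.1).symm⟩
    · rintro ⟨r, hr, _, ⟨x, hx, rfl⟩, hy⟩
      refine ⟨r, hr, _, ⟨⟨L.symm x.1, by simp⟩, ?_, rfl⟩, ?_⟩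
      · have : act σ ⟨L.symm x.1, by simp⟩ = x := Subtype.ext (L.apply_symm_apply x.1)
        rwa [this]
      · rw [← L.symm.map_smul, hy, L.symm_apply_apply]
  rw [hcone, L.measurePreserving.measure_preimage_emb L.toHomeomorph.measurableEmbedding]

lemma dotKernel_smul_smul (κ : ℝ → ℝ) (G : Subgroup (Equiv.Perm (Fin d))) (σ : G) (x y : Sph d) :
    dotKernel d κ (σ • x) (σ • y) = dotKernel d κ x y :=
  congrArg κ ((LinearIsometryEquiv.piLpCongrLeft 2 ℝ ℝ σ.1).inner_map_map x.1 y.1)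

lemma measurable_dotKernel {κ : ℝ → ℝ} (hκ : Measurable fun t : Set.Icc (-1 : ℝ) 1 ↦ κ t)
    (y : Sph d) : Measurable fun x ↦ dotKernel d κ x y := by
  have hmem (x : Sph d) : inner ℝ x.1 y.1 ∈ Set.Icc (-1 : ℝ) 1 :=
    abs_le.1 ((abs_real_inner_le_norm _ _).trans_eq (by simp))
  have hinner : Measurable fun x : Sph d ↦ (⟨inner ℝ x.1 y.1, hmem x⟩ : Set.Icc (-1 : ℝ) 1) :=
    (continuous_subtype_val.inner continuous_const).measurable.subtype_mk
  exact hκ.comp hinner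

lemma dotKernel_self (κ : ℝ → ℝ) (x : Sph d) : dotKernel d κ x x = κ 1 := by
  simp [dotKernel]

open Classical in
lemma invKernel_eq_avgKernel (G : Subgroup (Equiv.Perm (Fin d))) (κ : ℝ → ℝ) :
    invKernel G κ = avgKernel G (dotKernel d κ) := rfl

end Sphere

/-- Comparison of infima: competitors in either space are matched by no worse ones in the other. -/
lemma approxError_le_of_forall_exists {d : ℕ} {H HG : Type*}
    [NormedAddCommGroup H] [InnerProductSpace ℝ H] [RKHS ℝ H (Sph d) ℝ]
    [NormedAddCommGroup HG] [InnerProductSpace ℝ HG] [RKHS ℝ HG (Sph d) ℝ]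
    {lam : ℝ} (hlam : 0 ≤ lam) {fstar : Sph d → ℝ}
    (h : ∀ F : HG, ∃ f : H, ‖f‖ ≤ ‖F‖ ∧
      ∫ x, (f x - fstar x) ^ 2 ∂(unif d) ≤ ∫ x, (F x - fstar x) ^ 2 ∂(unif d)) :
    approxError H lam fstar ≤ approxError HG lam fstar := by
  refine le_ciInf fun F ↦ ?_
  obtain ⟨f, hnorm, hint⟩ := h F
  have hbdd : BddBelow (Set.range fun f : H ↦
      (∫ x, (f x - fstar x) ^ 2 ∂(unif d)) + lam * ‖f‖ ^ 2) := by
    refine ⟨0, ?_⟩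
    rintro _ ⟨g, rfl⟩
    have : 0 ≤ ∫ x, (g x - fstar x) ^ 2 ∂(unif d) := integral_nonneg fun x ↦ sq_nonneg _
    positivity
  refine (ciInf_le hbdd f).trans ?_
  gcongr

end InvariantKernel

theorem mainTheorem8 (d : ℕ) (hd : 1 ≤ d) (G : Subgroup (Equiv.Perm (Fin d)))
    (κ : ℝ → ℝ) (hκ : Measurable (fun t : Set.Icc (-1 : ℝ) 1 => κ t))
    (hK : (InvariantKernel.dotKernel d κ).PosSemidef) :
    (InvariantKernel.invKernel G κ).PosSemidef ∧
    ∀ (H : Type*) [NormedAddCommGroup H] [InnerProductSpace ℝ H] [CompleteSpace H]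
      [RKHS ℝ H (InvariantKernel.Sph d) ℝ]
      (HG : Type*) [NormedAddCommGroup HG] [InnerProductSpace ℝ HG] [CompleteSpace HG]
      [RKHS ℝ HG (InvariantKernel.Sph d) ℝ],
      InvariantKernel.HasKernel H (InvariantKernel.dotKernel d κ) →
      InvariantKernel.HasKernel HG (InvariantKernel.invKernel G κ) →
      (∀ f : H, MemLp (⇑f) 2 (InvariantKernel.unif d)) ∧
      (∀ f : HG, MemLp (⇑f) 2 (InvariantKernel.unif d)) ∧
      ∀ (fstar : InvariantKernel.Sph d → ℝ), MemLp fstar 2 (InvariantKernel.unif d) →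
        (∀ σ ∈ G, ∀ᵐ x ∂(InvariantKernel.unif d),
          fstar (InvariantKernel.act σ x) = fstar x) →
        ∀ lam : ℝ, 0 ≤ lam →
          InvariantKernel.approxError H lam fstar =
            InvariantKernel.approxError HG lam fstar := by
  classical
  have hinv := InvariantKernel.dotKernel_smul_smul κ G
  rw [InvariantKernel.invKernel_eq_avgKernel]
  refine ⟨InvariantKernel.posSemidef_avgKernel hinv hK, ?_⟩
  intro H _ _ _ _ HG _ _ _ _ hH hHG
  have := InvariantKernel.isFiniteMeasure_unif hd
  have hmemH (f : H) : MemLp f 2 (InvariantKernel.unif d) :=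
    hH.memLp (InvariantKernel.measurable_dotKernel hκ)
      (fun x ↦ (InvariantKernel.dotKernel_self κ x).le) _ f
  refine ⟨hmemH, fun F ↦ ?_, fun fstar hfstar hfinv lam hlam ↦ le_antisymm ?_ ?_⟩
  · obtain ⟨f, -, hf⟩ := InvariantKernel.exists_coe_eq hinv hH hHG F
    exact hf ▸ hmemH f
  · refine InvariantKernel.approxError_le_of_forall_exists hlam fun F ↦ ?_
    obtain ⟨f, hnorm, hf⟩ := InvariantKernel.exists_coe_eq hinv hH hHG F
    exact ⟨f, hnorm, by rw [hf]⟩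
  · refine InvariantKernel.approxError_le_of_forall_exists hlam fun f ↦ ?_
    obtain ⟨F, hnorm, hF⟩ := InvariantKernel.exists_orbitMean hinv hH hHG f
    exact ⟨F, hnorm, InvariantKernel.integral_orbitMean_sub_sq_le
      (fun g : G ↦ InvariantKernel.measurePreserving_act g.1) (hmemH f) hfstar hF
      fun g ↦ hfinv g.1 g.2⟩
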